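/- For integers $m,n\ge 1$ let $K_{m\times n}$ be the complete multipartite graph with $m$ parts of size $n$, with vertex set $\mathbb{Z}_{mn}$ and with the cosets of the subgroup $m\mathbb{Z}_{mn}$ as its parts; thus $x,y\in\mathbb{Z}_{mn}$ are adjacent if and only if $x-y\notin m\mathbb{Z}_{mn}$. A $2$-factor of a graph $\Gamma$ is a set of cycles of $\Gamma$ (each of length at least $3$) whose vertex sets partition $V(\Gamma)$, and a $2$-factorization of $\Gamma$ is a set $\mathcal{F}$ of $2$-factors such that every edge of $\Gamma$ appears in exactly one member of $\mathcal{F}$. It is hamiltonian if every cycle appearing in it has length $|V(\Gamma)|$, i.e. if every $2$-factor is a hamiltonian cycle. A $2$-factorization $\mathcal{F}$ of $K_{m\times n}$ is cyclic if $F+g\in\mathcal{F}$ for all $F\in\mathcal{F}$ and all $g\in\mathbb{Z}_{mn}$, where $F+g$ is the image of $F$ under the translation $x\mapsto x+g$. Proposition. Let $m\geq 1$ be an odd integer and let $n\equiv 2\pmod 4$ with $n>2$. Then there exists a cyclic hamiltonian $2$-factorization of $K_{m\times n}$ if and only if $m\equiv 1\pmod 4$. (For $m=1$ the graph has no edges and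 the empty $2$-factorization qualifies.) -/

import Mathlib

namespace CyclicFactorization

/-- The closed sequence `(c₀, c₁, …, c_{ℓ-1})` as a graph on `V`: its edges are the pairs
`[cᵢ, cᵢ₊₁]`, indices modulo `ℓ`. Its vertices, when it is a cycle, are the non-isolated points
(`SimpleGraph.support`). -/
def closedTrail {V : Type*} {ℓ : ℕ} (c : ZMod ℓ → V) : SimpleGraph V :=
  SimpleGraph.fromRel fun x y => ∃ i : ZMod ℓ, x = c i ∧ y = c (i + 1)

/-- `C` is a cycle of length `ℓ` contained in the graph `Γ`. -/
def IsCycleOfLength {V : Type*} (Γ : SimpleGraph V) (ℓ : ℕ) (C : SimpleGraph V) : Prop :=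
  3 ≤ ℓ ∧ ∃ c : ZMod ℓ → V, Function.Injective c ∧
    (∀ i : ZMod ℓ, Γ.Adj (c i) (c (i + 1))) ∧ C = closedTrail c

/-- A `2`-factor of `Γ`: a set of cycles of `Γ` whose vertices partition the vertex set. -/
def IsTwoFactor {V : Type*} (Γ : SimpleGraph V) (F : Set (SimpleGraph V)) : Prop :=
  (∀ C ∈ F, ∃ ℓ : ℕ, IsCycleOfLength Γ ℓ C) ∧
    ∀ v : V, ∃! C : SimpleGraph V, C ∈ F ∧ v ∈ C.support

/-- A `2`-factorization of `Γ`: a set of `2`-factors such that any edge of `Γ` appears in exactly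
one of them. -/
def IsTwoFactorization {V : Type*} (Γ : SimpleGraph V)
    (𝓕 : Set (Set (SimpleGraph V))) : Prop :=
  (∀ F ∈ 𝓕, IsTwoFactor Γ F) ∧
    ∀ e ∈ Γ.edgeSet, ∃! F : Set (SimpleGraph V), F ∈ 𝓕 ∧ ∃ C ∈ F, e ∈ C.edgeSet

/-- A `C_ℓ`-factorization: a `2`-factorization all of whose cycles have length `ℓ`. -/
def IsCycleFactorization {V : Type*} (Γ : SimpleGraph V) (ℓ : ℕ)
    (𝓕 : Set (Set (SimpleGraph V))) : Prop :=
  IsTwoFactorization Γ 𝓕 ∧ ∀ F ∈ 𝓕, ∀ C ∈ F, IsCycleOfLength Γ ℓ C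

/-- A hamiltonian `2`-factorization: all cycles have length the number of vertices. -/
def IsHamiltonianTwoFactorization {V : Type*} (Γ : SimpleGraph V)
    (𝓕 : Set (Set (SimpleGraph V))) : Prop :=
  IsCycleFactorization Γ (Nat.card V) 𝓕

/-- The translate `C + g` of a graph with vertices in `G`. -/
def translate {G : Type*} [AddGroup G] (g : G) (C : SimpleGraph G) : SimpleGraph G :=
  C.map (Equiv.addRight g).toEmbedding

/-- Regularity under the action of `G` by translation: `F + g ∈ 𝓕` for all `F ∈ 𝓕`, `g ∈ G`. -/
def IsRegularUnderTranslation {G : Type*} [AddGroup G]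
    (𝓕 : Set (Set (SimpleGraph G))) : Prop :=
  ∀ F ∈ 𝓕, ∀ g : G, translate g '' F ∈ 𝓕

/-- `K_{m × n}`: the complete multipartite graph with vertex set `ℤ/mnℤ` whose parts are the
cosets of the subgroup `mℤ/mnℤ`. -/
def multipartiteGraph (m n : ℕ) : SimpleGraph (ZMod (m * n)) where
  Adj x y := x - y ∉ AddSubgroup.zmultiples (m : ZMod (m * n))
  symm := ⟨fun x y h h' => h (by simpa using neg_mem h')⟩
  loopless := ⟨fun x h => h (by simp)⟩

end CyclicFactorization

namespace CyclicFactorization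

/-! Write `v = m * n = 2 * N`; under the hypotheses `N` is odd.

Necessity is a double count modulo 8 of the ordered pairs `(x, y)` that are adjacent in some cycle
and have `x`, `y` of equal parity. A closed walk of even length has an even number of
parity-preserving edges, so each hamiltonian cycle contributes a multiple of 4
(`four_dvd_card_evenDarts`). Translation by `N` is an involution on the cycles. Cycles that it moves
pair off with equal contributions. A cycle that it fixes is rotated by half a turn
(`rotation_of_translate_eq`), and since `N` is odd its contribution is a multiple of 8
(`eight_dvd_card_evenDarts`). So the total is divisible by 8. The total is also `m * n` times the
number of even elements outside the subgroup generated by `m`, which for `m ≡ 3` modulo 4 is four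
times an odd number.

Sufficiency is by differences. A base cycle that is invariant under translation by some `g` is
determined by one period of steps. If the steps of all base cycles over one period, with both signs,
exhaust the nonmultiples of `m` without repetition, then the translates of the base cycles, each
taken as a 2-factor by itself, form the factorization (`exists_factorization_of_walks`). For `m = 4t
+ 1 > 1` and `n = 4B + 2` the differences are, up to sign, `2z` and `N + 2z` with `z = 2w + 1 + m *
l`, `w < 2t`, `|l| ≤ B`. The walks `zigzagWalk`, of period `m`, use all the even differences and
some odd ones; walks of period 2 and at most one of period 1 use up the remaining odd ones
(`baseWalk_covers`). -/

theorem closedTrail_adj {V : Type*} {ℓ : ℕ} (hℓ : 3 ≤ ℓ) {c : ZMod ℓ → V}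
    (hc : Function.Injective c) (x y : V) :
    (closedTrail c).Adj x y ↔ ∃ i : ZMod ℓ, x = c i ∧ y = c (i + 1) ∨ y = c i ∧ x = c (i + 1) := by
  have : Fact (1 < ℓ) := ⟨by omega⟩
  rw [closedTrail, SimpleGraph.fromRel_adj]
  constructor
  · rintro ⟨-, ⟨i, h⟩ | ⟨i, h⟩⟩
    · exact ⟨i, Or.inl h⟩
    · exact ⟨i, Or.inr h⟩
  · rintro ⟨i, ⟨rfl, rfl⟩ | ⟨rfl, rfl⟩⟩
    · exact ⟨fun h => by simpa using hc h, Or.inl ⟨i, rfl, rfl⟩⟩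
    · exact ⟨fun h => by simpa using hc h, Or.inr ⟨i, rfl, rfl⟩⟩

theorem two_ne_zero_zmod {ℓ : ℕ} (hℓ : 3 ≤ ℓ) : (2 : ZMod ℓ) ≠ 0 := by
  intro h
  have := (ZMod.natCast_eq_zero_iff 2 ℓ).1 (by exact_mod_cast h)
  exact absurd (Nat.le_of_dvd (by norm_num) this) (by omega)

theorem closedTrail_support {V : Type*} {ℓ : ℕ} (hℓ : 3 ≤ ℓ) {c : ZMod ℓ → V}
    (hc : Function.Bijective c) (x : V) : x ∈ (closedTrail c).support := by
  obtain ⟨i, rfl⟩ := hc.2 x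
  rw [SimpleGraph.mem_support]
  exact ⟨c (i + 1), (closedTrail_adj hℓ hc.1 _ _).2 ⟨i, Or.inl ⟨rfl, rfl⟩⟩⟩

theorem translate_closedTrail {G : Type*} [AddGroup G] {ℓ : ℕ} (g : G) (c : ZMod ℓ → G) :
    translate g (closedTrail c) = closedTrail fun i => c i + g := by
  ext x y
  simp only [translate, closedTrail, SimpleGraph.map_adj, SimpleGraph.fromRel_adj]
  constructor
  · rintro ⟨a, b, ⟨hab, h⟩, rfl, rfl⟩
    refine ⟨by simpa using hab, ?_⟩
    rcases h with ⟨i, rfl, rfl⟩ | ⟨i, rfl, rfl⟩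
    · exact Or.inl ⟨i, by simp⟩
    · exact Or.inr ⟨i, by simp⟩
  · rintro ⟨hxy, h⟩
    refine ⟨x - g, y - g, ⟨by simpa using hxy, ?_⟩, by simp, by simp⟩
    rcases h with ⟨i, rfl, rfl⟩ | ⟨i, rfl, rfl⟩
    · exact Or.inl ⟨i, by simp⟩
    · exact Or.inr ⟨i, by simp⟩

theorem translate_adj {G : Type*} [AddGroup G] (g : G) (C : SimpleGraph G) (x y : G) :
    (translate g C).Adj (x + g) (y + g) ↔ C.Adj x y := by
  have := SimpleGraph.map_adj_apply (G := C) (f := (Equiv.addRight g).toEmbedding) (a := x) (b := y)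
  simpa [translate] using this

/-! ### Necessity: parity-preserving edges of hamiltonian cycles -/

section Parity

theorem ite_eq_zmod_two (a b : ZMod 2) : (if b = a then (1 : ZMod 2) else 0) = 1 - (b - a) := by
  revert a b; decide

/-- The number of constant steps of a walk in `ZMod 2` is determined modulo `2` by its ends. -/
theorem card_const_steps (u : ℕ → ZMod 2) (M : ℕ) :
    (((Finset.range M).filter fun i => u (i + 1) = u i).card : ZMod 2) = M - (u M - u 0) := by
  rw [Finset.card_filter]
  push_cast
  simp_rw [ite_eq_zmod_two]
  rw [Finset.sum_sub_distrib, Finset.sum_range_sub]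
  simp

/-- The ordered pairs of `C`-adjacent vertices in the same fibre of `π`. -/
noncomputable def evenDarts {V W : Type*} [Fintype V] (π : V → W) (C : SimpleGraph V) :
    Finset (V × V) := by
  classical exact Finset.univ.filter fun p => C.Adj p.1 p.2 ∧ π p.1 = π p.2

theorem mem_evenDarts {V W : Type*} [Fintype V] (π : V → W) (C : SimpleGraph V) (p : V × V) :
    p ∈ evenDarts π C ↔ C.Adj p.1 p.2 ∧ π p.1 = π p.2 := by
  simp [evenDarts]

theorem card_evenDarts_closedTrail {V W : Type*} [Fintype V] [DecidableEq W] (π : V → W) {v : ℕ}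
    (hv : 3 ≤ v) {c : ZMod v → V} (hc : Function.Injective c) :
    (evenDarts π (closedTrail c)).card =
      2 * ((Finset.range v).filter fun i : ℕ =>
        π (c ((i + 1 : ℕ) : ZMod v)) = π (c (i : ZMod v))).card := by
  classical
  have : NeZero v := ⟨by omega⟩
  set A := (Finset.range v).filter fun i : ℕ =>
        π (c ((i + 1 : ℕ) : ZMod v)) = π (c (i : ZMod v)) with hA
  set f : ℕ → V × V := fun i => (c (i : ZMod v), c ((i + 1 : ℕ) : ZMod v)) with hf
  set f' : ℕ → V × V := fun i => (c ((i + 1 : ℕ) : ZMod v), c (i : ZMod v)) with hf'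
  have key : ∀ i ∈ A, ∀ j ∈ A, c (i : ZMod v) = c (j : ZMod v) → i = j := by
    intro i hi j hj h
    have hi := Finset.mem_range.1 (Finset.mem_filter.1 hi).1
    have hj := Finset.mem_range.1 (Finset.mem_filter.1 hj).1
    have := (ZMod.natCast_eq_natCast_iff' _ _ _).1 (hc h)
    rwa [Nat.mod_eq_of_lt hi, Nat.mod_eq_of_lt hj] at this
  have h1 : (A.image f).card = A.card :=
    Finset.card_image_of_injOn fun i hi j hj h => key i hi j hj (congrArg Prod.fst h)
  have h2 : (A.image f').card = A.card :=
    Finset.card_image_of_injOn fun i hi j hj h => key i hi j hj (congrArg Prod.snd h)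
  have hd : Disjoint (A.image f) (A.image f') := by
    rw [Finset.disjoint_left]
    intro p hp hp'
    obtain ⟨i, -, rfl⟩ := Finset.mem_image.1 hp
    obtain ⟨j, -, h⟩ := Finset.mem_image.1 hp'
    have e1 := hc (congrArg Prod.fst h)
    have e2 := hc (congrArg Prod.snd h)
    apply two_ne_zero_zmod hv
    push_cast at e1 e2
    linear_combination e1 - e2
  have hu : evenDarts π (closedTrail c) = A.image f ∪ A.image f' := by
    ext ⟨x, y⟩
    rw [mem_evenDarts, closedTrail_adj hv hc, Finset.mem_union, Finset.mem_image, Finset.mem_image]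
    constructor
    · rintro ⟨⟨i, ⟨rfl, rfl⟩ | ⟨rfl, rfl⟩⟩, h⟩
      · exact Or.inl ⟨i.val, by simp [hA, ZMod.val_lt, h.symm], by simp [hf]⟩
      · exact Or.inr ⟨i.val, by simp [hA, ZMod.val_lt, h], by simp [hf']⟩
    · rintro (⟨i, hi, h⟩ | ⟨i, hi, h⟩)
      · obtain ⟨rfl, rfl⟩ := Prod.mk.inj h
        exact ⟨⟨i, Or.inl ⟨rfl, by push_cast; rfl⟩⟩, (Finset.mem_filter.1 hi).2.symm⟩
      · obtain ⟨rfl, rfl⟩ := Prod.mk.inj h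
        exact ⟨⟨i, Or.inr ⟨rfl, by push_cast; rfl⟩⟩, (Finset.mem_filter.1 hi).2⟩
  rw [hu, Finset.card_union_of_disjoint hd, h1, h2]
  ring

theorem card_evenDarts_translate {G W : Type*} [AddGroup G] [AddGroup W] [Fintype G] (π : G →+ W)
    (g : G) (C : SimpleGraph G) :
    (evenDarts π (translate g C)).card = (evenDarts π C).card := by
  classical
  symm
  apply Finset.card_bij fun p _ => (p.1 + g, p.2 + g)
  · intro p hp
    rw [mem_evenDarts] at hp ⊢
    exact ⟨(translate_adj g C _ _).2 hp.1, by simp [hp.2]⟩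
  · rintro ⟨a, b⟩ - ⟨a', b'⟩ - h
    simpa using h
  · rintro ⟨a, b⟩ hp
    rw [mem_evenDarts] at hp
    refine ⟨(a - g, b - g), ?_, by simp⟩
    rw [mem_evenDarts, ← translate_adj g]
    simpa [sub_eq_add_neg] using hp

end Parity

/-- A hamiltonian cycle invariant under the translation of order two, none of whose edges is
reversed by this translation, is rotated by half a turn. -/
theorem rotation_of_translate_eq {v N : ℕ} (hN : 2 ≤ N) (hvN : v = 2 * N) {c : ZMod v → ZMod v}
    (hc : Function.Bijective c) (hne : ∀ i, c (i + 1) ≠ c i + N)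
    (h : translate (N : ZMod v) (closedTrail c) = closedTrail c)
    (i : ZMod v) : c (i + N) = c i + N := by
  subst hvN
  have : NeZero (2 * N) := ⟨by omega⟩
  have hv : 3 ≤ 2 * N := by omega
  have h2N : (N : ZMod (2 * N)) + N = 0 := by
    have := ZMod.natCast_self (2 * N)
    push_cast at this
    linear_combination this
  have hN0 : (N : ZMod (2 * N)) ≠ 0 := by
    intro h
    have := Nat.le_of_dvd (by omega) ((ZMod.natCast_eq_zero_iff _ _).1 h)
    omega
  have h20 := two_ne_zero_zmod hv
  -- The translation is carried to the indices of the cycle as a fixed-point-free involution `σ`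
  -- preserving adjacency.
  choose σ hσ using fun i => hc.2 (c i + N)
  have hinj : Function.Injective σ := fun a b hab => by
    have := hσ a
    rw [hab, hσ b] at this
    exact hc.1 (add_right_cancel this).symm
  have hσσ : ∀ i, σ (σ i) = i := fun i => hc.1 (by rw [hσ, hσ, add_assoc, h2N, add_zero])
  have hfix : ∀ i, σ i ≠ i := fun i hi => by
    have := hσ i
    rw [hi] at this
    exact hN0 (by simpa using this.symm)
  have hstep : ∀ i, σ (i + 1) = σ i + 1 ∨ σ (i + 1) = σ i - 1 := by
    intro i
    have h1 : (closedTrail c).Adj (c i + N) (c (i + 1) + N) := by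
      rw [← h, translate_adj, closedTrail_adj hv hc.1]
      exact ⟨i, Or.inl ⟨rfl, rfl⟩⟩
    rw [← hσ, ← hσ, closedTrail_adj hv hc.1] at h1
    obtain ⟨j, ⟨e1, e2⟩ | ⟨e1, e2⟩⟩ := h1
    · left; rw [hc.1 e1, hc.1 e2]
    · right; rw [hc.1 e1, hc.1 e2]; ring
  have hn2 : ∀ i : ZMod (2 * N), σ (i + 1 + 1) ≠ σ i := fun i hi => h20 (by
    have := hinj hi
    linear_combination this)
  have hnat : ∀ i : ZMod (2 * N), ∃ k : ℕ, (k : ZMod (2 * N)) = i := fun i => ⟨i.val, by simp⟩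
  -- Injectivity prevents `σ` from turning back, so the sign at `0` decides between a rotation and a
  -- reflection. A rotation of order two is the half turn.
  rcases hstep 0 with h0 | h0
  · have hall : ∀ k : ℕ, σ ((k : ZMod (2 * N)) + 1) = σ k + 1 := by
      intro k
      induction k with
      | zero => simpa using h0
      | succ k ih =>
        push_cast
        rcases hstep (k + 1) with h1 | h1
        · exact h1
        · exact absurd (by rw [h1, ih]; ring) (hn2 k)
    have hlin : ∀ k : ℕ, σ (k : ZMod (2 * N)) = k + σ 0 := by
      intro k
      induction k with
      | zero => simp
      | succ k ih => push_cast; rw [hall, ih]; ring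
    have hlin' : ∀ i, σ i = i + σ 0 := fun i => by
      obtain ⟨k, rfl⟩ := hnat i; exact hlin k
    have hs : σ 0 + σ 0 = 0 := by rw [← hlin', hσσ]
    have hs0 : σ 0 = N := by
      obtain ⟨k, hk⟩ : ∃ k : ℕ, k < 2 * N ∧ (k : ZMod (2 * N)) = σ 0 :=
        ⟨(σ 0).val, ZMod.val_lt _, by simp⟩
      have hk0 : k ≠ 0 := by
        rintro rfl
        exact hfix 0 (by simpa using hk.2.symm)
      rw [← hk.2] at hs ⊢
      obtain ⟨q, hq⟩ := (ZMod.natCast_eq_zero_iff (k + k) (2 * N)).1 (by push_cast; exact hs)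
      have : q = 1 := by
        have h1 : q < 2 := by nlinarith
        interval_cases q <;> omega
      subst this
      congr 1
      omega
    rw [← hs0, ← hlin' i, hs0, hσ]
  · exfalso
    have hall : ∀ k : ℕ, σ ((k : ZMod (2 * N)) + 1) = σ k - 1 := by
      intro k
      induction k with
      | zero => simpa using h0
      | succ k ih =>
        push_cast
        rcases hstep (k + 1) with h1 | h1
        · exact absurd (by rw [h1, ih]; ring) (hn2 k)
        · exact h1
    have hlin : ∀ k : ℕ, σ (k : ZMod (2 * N)) = σ 0 - k := by
      intro k
      induction k with
      | zero => simp
      | succ k ih => push_cast; rw [hall, ih]; ring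
    -- A reflection `i ↦ s - i` fixes an index if `s` is even and reverses an edge if `s` is odd;
    -- the reversed edge would have difference `N`.
    obtain ⟨s, hs⟩ := hnat (σ 0)
    obtain ⟨a, ha⟩ := Nat.even_or_odd' s
    rcases ha with rfl | rfl
    · exact hfix a (by rw [hlin, ← hs]; push_cast; ring)
    · apply hne a
      rw [← hσ]
      congr 1
      rw [hlin, ← hs]; push_cast; ring

/-- Reduction modulo `2` on `ZMod v` for even `v`. -/
noncomputable def parity {v N : ℕ} (hvN : v = 2 * N) : ZMod v →+ ZMod 2 :=
  (ZMod.castHom (Dvd.intro N hvN.symm) (ZMod 2)).toAddMonoidHom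

theorem parity_natCast {v N : ℕ} (hvN : v = 2 * N) (a : ℕ) : parity hvN (a : ZMod v) = a := by
  simp [parity]

theorem natCast_eq_one_of_odd {N : ℕ} (hN : Odd N) : (N : ZMod 2) = 1 :=
  ZMod.natCast_eq_one_iff_odd.2 hN

theorem natCast_half_add_self {v N : ℕ} (hvN : v = 2 * N) : (N : ZMod v) + N = 0 := by
  have := ZMod.natCast_self v
  rw [hvN] at this ⊢
  push_cast at this
  linear_combination this

/-- A closed walk changes parity an even number of times, and its length is even, so it has an even
number of parity-preserving steps. Each of them gives two ordered pairs. -/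
theorem four_dvd_card_evenDarts {v N : ℕ} [NeZero v] (hN : 2 ≤ N) (hvN : v = 2 * N) {c : ZMod v → ZMod v}
    (hc : Function.Injective c) : 4 ∣ (evenDarts (parity hvN) (closedTrail c)).card := by
  rw [card_evenDarts_closedTrail _ (by omega) hc]
  refine mul_dvd_mul_left (b := 2) 2 ?_
  rw [← ZMod.natCast_eq_zero_iff]
  have := card_const_steps (fun i => parity hvN (c (i : ZMod v))) v
  rw [this]
  simp only [ZMod.natCast_self, Nat.cast_zero, sub_self, sub_zero]
  rw [hvN, Nat.cast_mul]
  simp [show (2 : ZMod 2) = 0 from rfl]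

/-- Half a turn adds the odd number `N`, so it flips every parity and both halves of the cycle have
equally many parity-preserving steps. One half has `N` steps and ends of opposite parity, so this
number is congruent to `N - 1`, hence even. -/
theorem eight_dvd_card_evenDarts {v N : ℕ} [NeZero v] (hN : 2 ≤ N) (hodd : Odd N) (hvN : v = 2 * N)
    {c : ZMod v → ZMod v} (hc : Function.Bijective c) (hne : ∀ i, c (i + 1) ≠ c i + N)
    (h : translate (N : ZMod v) (closedTrail c) = closedTrail c) :
    8 ∣ (evenDarts (parity hvN) (closedTrail c)).card := by
  have hrot := rotation_of_translate_eq hN hvN hc hne h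
  rw [card_evenDarts_closedTrail _ (by omega) hc.1]
  set u : ℕ → ZMod 2 := fun i => parity hvN (c (i : ZMod v)) with hu
  have hs : ∀ i, u (i + N) = u i + 1 := fun i => by
    simp only [hu]
    push_cast
    rw [hrot, map_add, parity_natCast, natCast_eq_one_of_odd hodd]
  have h1 : ((Finset.range v).filter fun i => u (i + 1) = u i).card =
      2 * ((Finset.range N).filter fun i => u (i + 1) = u i).card := by
    rw [Finset.card_filter, Finset.card_filter, hvN, two_mul N, Finset.sum_range_add, two_mul]
    congr 1
    refine Finset.sum_congr rfl fun i _ => ?_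
    rw [show N + i + 1 = (i + 1) + N by ring, show N + i = i + N by ring, hs, hs]
    simp
  have h2 : 2 ∣ ((Finset.range N).filter fun i => u (i + 1) = u i).card := by
    rw [← ZMod.natCast_eq_zero_iff, card_const_steps, natCast_eq_one_of_odd hodd]
    have := hs 0
    rw [zero_add] at this
    rw [this]
    ring
  obtain ⟨q, hq⟩ := h2
  change 8 ∣ 2 * ((Finset.range v).filter fun i => u (i + 1) = u i).card
  rw [h1, hq]
  exact ⟨q, by ring⟩

theorem natCard_zmultiples {m n : ℕ} (hm : 0 < m) (hn : 0 < n) :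
    Nat.card (AddSubgroup.zmultiples (m : ZMod (m * n))) = n := by
  rw [Nat.card_zmultiples, ZMod.addOrderOf_coe _ (by positivity), Nat.gcd_comm,
    Nat.gcd_eq_left (Dvd.intro n rfl), Nat.mul_div_cancel_left _ hm]

theorem card_not_mem_zmultiples {m n : ℕ} (hm : 0 < m) (hn : 0 < n) (S : Finset (ZMod (m * n)))
    (hS : ∀ x, x ∈ S ↔ x ∉ AddSubgroup.zmultiples (m : ZMod (m * n))) :
    S.card = m * n - n := by
  classical
  have : NeZero (m * n) := ⟨by positivity⟩
  have h := Finset.card_compl S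
  rw [ZMod.card] at h
  have h2 : Sᶜ.card = n := by
    have h4 : Nat.card (AddSubgroup.zmultiples (m : ZMod (m * n))) = Sᶜ.card :=
      Nat.subtype_card Sᶜ fun x => by simp [hS]
    rw [← h4, natCard_zmultiples hm hn]
  have h3 : S.card ≤ m * n := by
    simpa [ZMod.card] using Finset.card_le_univ S
  omega

/-- Half of the elements outside `mℤ` are even. -/
theorem two_mul_card_even_not_mem_zmultiples {m n N k : ℕ} (hm : 0 < m) (hk : 0 < k)
    (hn : n = 2 * k) (hN : N = m * k) (hodd : Odd N) (hvN : m * n = 2 * N)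
    (S : Finset (ZMod (m * n)))
    (hS : ∀ x, x ∈ S ↔ x ∉ AddSubgroup.zmultiples (m : ZMod (m * n)) ∧ parity hvN x = 0) :
    2 * S.card = m * n - n := by
  classical
  have : NeZero (m * n) := ⟨by subst hn; positivity⟩
  have hNm : (N : ZMod (m * n)) ∈ AddSubgroup.zmultiples (m : ZMod (m * n)) :=
    ⟨k, by simp [hN, mul_comm]⟩
  have hpN : parity hvN (N : ZMod (m * n)) = 1 := by
    rw [parity_natCast, natCast_eq_one_of_odd hodd]
  have hNN := natCast_half_add_self hvN
  set f : ZMod (m * n) → ZMod (m * n) := fun x => x + N with hf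
  have hff : Function.Injective f := fun a b h => add_right_cancel h
  -- Adding `N`, an odd multiple of `m`, exchanges the even and the odd elements outside the
  -- subgroup.
  have hd : Disjoint S (S.image f) := by
    rw [Finset.disjoint_left]
    intro x hx hx'
    obtain ⟨y, hy, rfl⟩ := Finset.mem_image.1 hx'
    have h1 := ((hS _).1 hx).2
    rw [hf, map_add, hpN, ((hS _).1 hy).2] at h1
    exact absurd h1 (by decide)
  have h1 := card_not_mem_zmultiples hm (by omega) (S ∪ S.image f) (by
    intro x
    rw [Finset.mem_union, Finset.mem_image]
    constructor
    · rintro (h | ⟨y, hy, rfl⟩)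
      · exact ((hS _).1 h).1
      · intro h
        exact ((hS _).1 hy).1 ((AddSubgroup.add_mem_cancel_right _ hNm).1 h)
    · intro hx
      have h01 : ∀ a : ZMod 2, a = 0 ∨ a = 1 := by decide
      rcases h01 (parity hvN x) with h | h
      · exact Or.inl ((hS _).2 ⟨hx, h⟩)
      · refine Or.inr ⟨x + N, (hS _).2 ⟨?_, ?_⟩, ?_⟩
        · rwa [AddSubgroup.add_mem_cancel_right _ hNm]
        · rw [map_add, h, hpN]; decide
        · simp only [hf]; rw [add_assoc, hNN, add_zero])
  rw [Finset.card_union_of_disjoint hd, Finset.card_image_of_injective _ hff] at h1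
  omega

theorem card_filter_sub {G : Type*} [AddGroup G] [Fintype G] [DecidableEq G] (S : Finset G) :
    (Finset.univ.filter fun p : G × G => p.1 - p.2 ∈ S).card = Fintype.card G * S.card := by
  rw [← Finset.card_univ, ← Finset.card_product]
  symm
  apply Finset.card_bij fun p _ => (p.2 + p.1, p.1)
  · rintro ⟨a, b⟩ h
    simpa using h
  · rintro ⟨a, b⟩ - ⟨a', b'⟩ - h
    obtain ⟨h1, rfl⟩ := Prod.mk.inj h
    simpa using h1
  · rintro ⟨a, b⟩ h
    exact ⟨(b, a - b), by simpa using h, by simp⟩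

theorem mod_four_of_factorization {m n : ℕ} (hm : Odd m) (hn : n ≡ 2 [MOD 4]) (hn2 : 2 < n)
    {𝓕 : Set (Set (SimpleGraph (ZMod (m * n))))}
    (hF : IsHamiltonianTwoFactorization (multipartiteGraph m n) 𝓕)
    (hreg : IsRegularUnderTranslation 𝓕) : m ≡ 1 [MOD 4] := by
  classical
  obtain ⟨k, hk, hkodd⟩ : ∃ k, n = 2 * k ∧ Odd k := by
    have : n % 4 = 2 := hn
    exact ⟨n / 2, by omega, ⟨n / 4, by omega⟩⟩
  have hm0 : 0 < m := hm.pos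
  set N := m * k with hN
  have hodd : Odd N := hm.mul hkodd
  have hvN : m * n = 2 * N := by rw [hk, hN]; ring
  have hN2 : 2 ≤ N := by rw [hN]; nlinarith
  have : NeZero (m * n) := ⟨by omega⟩
  set Γ := multipartiteGraph m n with hΓ
  have hNm : (N : ZMod (m * n)) ∈ AddSubgroup.zmultiples (m : ZMod (m * n)) :=
    ⟨k, by simp [hN, mul_comm]⟩
  have hNN := natCast_half_add_self hvN
  have hcyc : ∀ F ∈ 𝓕, ∀ C ∈ F, ∃ c : ZMod (m * n) → ZMod (m * n), Function.Bijective c ∧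
      (∀ i, Γ.Adj (c i) (c (i + 1))) ∧ C = closedTrail c := by
    intro F hFF C hC
    have := hF.2 F hFF C hC
    rw [Nat.card_zmod] at this
    obtain ⟨-, c, h1, h2, h3⟩ := this
    exact ⟨c, Finite.injective_iff_bijective.1 h1, h2, h3⟩
  set 𝒞 : Finset (SimpleGraph (ZMod (m * n))) := (Set.toFinite (⋃₀ 𝓕)).toFinset with h𝒞
  have mem𝒞 : ∀ C, C ∈ 𝒞 ↔ ∃ F ∈ 𝓕, C ∈ F := fun C => by simp [h𝒞]
  set D : SimpleGraph (ZMod (m * n)) → Finset (ZMod (m * n) × ZMod (m * n)) :=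
    evenDarts (parity hvN) with hD
  have htr : ∀ C ∈ 𝒞, translate (N : ZMod (m * n)) C ∈ 𝒞 := by
    intro C hC
    obtain ⟨F, hFF, hC⟩ := (mem𝒞 C).1 hC
    exact (mem𝒞 _).2 ⟨_, hreg F hFF N, C, hC, rfl⟩
  have hsum0 : ∑ C ∈ 𝒞, ((D C).card : ZMod 8) = 0 := by
    -- A moved cycle and its image contribute the same multiple of 4, so together 0 modulo 8; a
    -- fixed cycle contributes 0 by itself.
    apply Finset.sum_involution fun C _ => translate (N : ZMod (m * n)) C
    · intro C hC
      obtain ⟨F, hFF, hC⟩ := (mem𝒞 C).1 hC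
      obtain ⟨c, hc, -, rfl⟩ := hcyc F hFF C hC
      simp only [hD]
      rw [card_evenDarts_translate]
      obtain ⟨q, hq⟩ := four_dvd_card_evenDarts hN2 hvN hc.1
      rw [hq]
      push_cast
      have : (8 : ZMod 8) = 0 := rfl
      linear_combination (q : ZMod 8) * this
    · intro C hC hne heq
      obtain ⟨F, hFF, hC⟩ := (mem𝒞 C).1 hC
      obtain ⟨c, hc, hadj, rfl⟩ := hcyc F hFF C hC
      apply hne
      rw [ZMod.natCast_eq_zero_iff]
      refine eight_dvd_card_evenDarts hN2 hodd hvN hc (fun i hi => ?_) heq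
      have := hadj i
      rw [hi] at this
      exact this (by simpa using neg_mem hNm)
    · exact fun C hC => htr C hC
    · intro C hC
      obtain ⟨F, hFF, hC⟩ := (mem𝒞 C).1 hC
      obtain ⟨c, hc, hadj, rfl⟩ := hcyc F hFF C hC
      rw [translate_closedTrail, translate_closedTrail]
      simp only [add_assoc, hNN, add_zero]
  -- An edge determines its 2-factor, and a vertex determines the cycle within that 2-factor.
  have huniq : ∀ C ∈ 𝒞, ∀ C' ∈ 𝒞, ∀ x y, C.Adj x y → C'.Adj x y → C = C' := by
    intro C hC C' hC' x y h h'
    obtain ⟨F, hFF, hC⟩ := (mem𝒞 C).1 hC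
    obtain ⟨F', hFF', hC'⟩ := (mem𝒞 C').1 hC'
    have hxy : Γ.Adj x y := by
      obtain ⟨c, hc, hadj, rfl⟩ := hcyc F hFF C hC
      rw [closedTrail_adj (by omega) hc.1] at h
      obtain ⟨i, ⟨rfl, rfl⟩ | ⟨rfl, rfl⟩⟩ := h
      · exact hadj i
      · exact (hadj i).symm
    obtain ⟨F₀, -, hF₀⟩ := hF.1.2 s(x, y) hxy
    have e1 := hF₀ F ⟨hFF, C, hC, h⟩
    have e2 := hF₀ F' ⟨hFF', C', hC', h'⟩
    subst e1
    subst e2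
    exact ((hF.1.1 _ hFF).2 x).unique ⟨hC, (SimpleGraph.mem_support _).2 ⟨y, h⟩⟩
      ⟨hC', (SimpleGraph.mem_support _).2 ⟨y, h'⟩⟩
  set S : Finset (ZMod (m * n)) := Finset.univ.filter fun x =>
    x ∉ AddSubgroup.zmultiples (m : ZMod (m * n)) ∧ parity hvN x = 0 with hS
  have hScard := two_mul_card_even_not_mem_zmultiples hm0 hkodd.pos hk hN hodd hvN S
    (by simp [hS])
  have hunion : 𝒞.biUnion D = Finset.univ.filter fun p => p.1 - p.2 ∈ S := by
    ext ⟨x, y⟩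
    simp only [Finset.mem_biUnion, hD, mem_evenDarts, Finset.mem_filter, Finset.mem_univ, true_and,
      hS, map_sub, sub_eq_zero]
    constructor
    · rintro ⟨C, hC, h, he⟩
      refine ⟨?_, he⟩
      obtain ⟨F, hFF, hC⟩ := (mem𝒞 C).1 hC
      obtain ⟨c, hc, hadj, rfl⟩ := hcyc F hFF C hC
      rw [closedTrail_adj (by omega) hc.1] at h
      obtain ⟨i, ⟨rfl, rfl⟩ | ⟨rfl, rfl⟩⟩ := h
      · exact hadj i
      · exact (hadj i).symm
    · rintro ⟨hxy, he⟩
      obtain ⟨F, ⟨hFF, C, hC, h⟩, -⟩ := hF.1.2 s(x, y) hxy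
      exact ⟨C, (mem𝒞 C).2 ⟨F, hFF, hC⟩, h, he⟩
  have hcount : ∑ C ∈ 𝒞, (D C).card = m * n * S.card := by
    rw [← Finset.card_biUnion, hunion, card_filter_sub, ZMod.card]
    intro C hC C' hC' hne
    refine Finset.disjoint_left.2 ?_
    rintro ⟨x, y⟩ h h'
    simp only [hD, mem_evenDarts] at h h'
    exact hne (huniq C hC C' hC' x y h.1 h'.1)
  have h8 : 8 ∣ m * n * S.card := by
    rw [← ZMod.natCast_eq_zero_iff, ← hcount]
    exact_mod_cast hsum0
  by_contra hcon
  obtain ⟨s, rfl⟩ : ∃ s, m = 4 * s + 3 := by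
    obtain ⟨a, rfl⟩ := hm
    have : ¬ (2 * a + 1) % 4 = 1 := hcon
    exact ⟨a / 2, by omega⟩
  have hSc : S.card = k * (4 * s + 2) := by
    have : (4 * s + 3) * n - n = (4 * s + 2) * n := by
      rw [show (4 * s + 3) * n = (4 * s + 2) * n + n by ring]; simp
    have h3 : 2 * S.card = 2 * (k * (4 * s + 2)) := by
      rw [hScard, this]
      subst hk
      ring
    omega
  rw [hSc, show (4 * s + 3) * n = (4 * s + 3) * (2 * k) by rw [← hk], show (4 * s + 3) * (2 * k) * (k * (4 * s + 2)) =
    4 * ((4 * s + 3) * k * k * (2 * s + 1)) by ring] at h8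
  have h2 : 2 ∣ (4 * s + 3) * k * k * (2 * s + 1) :=
    Nat.dvd_of_mul_dvd_mul_left (by norm_num : 0 < 4) h8
  have ho : Odd ((4 * s + 3) * k * k * (2 * s + 1)) :=
    ((hm.mul hkodd).mul hkodd).mul ⟨s, rfl⟩
  exact (Nat.not_even_iff_odd.2 ho) (even_iff_two_dvd.2 h2)

/-! ### Sufficiency: factorizations from symmetric base walks -/

/-- A walk in `ZMod v` which closes up to a hamiltonian cycle after `v` steps and which is mapped
to itself by the translation by `g`, this translation shifting the indices by `ℓ`. -/
structure SymmetricHamiltonianWalk (v : ℕ) where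
  walk : ℕ → ZMod v
  period : ℕ
  shift : ZMod v
  period_pos : 0 < period
  walk_add_period : ∀ x, walk (x + period) = walk x + shift
  walk_add_card : ∀ x, walk (x + v) = walk x
  modEq_of_eq : ∀ x y, walk x = walk y → x ≡ y [MOD v]

namespace SymmetricHamiltonianWalk

variable {v : ℕ} (W : SymmetricHamiltonianWalk v)

theorem walk_mod (x : ℕ) : W.walk (x % v) = W.walk x := by
  conv_rhs => rw [← Nat.mod_add_div x v]
  generalize x / v = q
  induction q with
  | zero => simp
  | succ q ih => rw [mul_add, mul_one, ← add_assoc, W.walk_add_card, ih]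

theorem walk_add_mul_period (x q : ℕ) : W.walk (x + q * W.period) = W.walk x + q * W.shift := by
  induction q with
  | zero => simp
  | succ q ih => rw [add_mul, one_mul, ← add_assoc, W.walk_add_period, ih]; push_cast; ring

/-- The walk as a function on residues, translated by `t`. -/
def cycle (t : ZMod v) (i : ZMod v) : ZMod v := W.walk i.val + t

def step (x : ℕ) : ZMod v := W.walk (x + 1) - W.walk x

theorem step_mod_period (x : ℕ) : W.step (x % W.period) = W.step x := by
  have h1 := W.walk_add_mul_period (x % W.period) (x / W.period)
  have h2 := W.walk_add_mul_period (x % W.period + 1) (x / W.period)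
  have h3 := Nat.mod_add_div' x W.period
  rw [add_right_comm, h3] at h2
  rw [h3] at h1
  rw [step, step, h1, h2]
  ring

theorem cycle_natCast (t : ZMod v) (x : ℕ) : W.cycle t (x : ZMod v) = W.walk x + t := by
  rw [cycle, ZMod.val_natCast, W.walk_mod]

theorem closedTrail_eq_of_forall {V : Type*} {c c' : ZMod v → V} (z : ZMod v)
    (h : ∀ i, c' i = c (i + z)) : closedTrail c' = closedTrail c := by
  ext x y
  simp only [closedTrail, SimpleGraph.fromRel_adj]
  have key : ∀ x y, (∃ i : ZMod v, x = c' i ∧ y = c' (i + 1)) ↔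
      ∃ i : ZMod v, x = c i ∧ y = c (i + 1) := by
    intro x y
    constructor
    · rintro ⟨i, rfl, rfl⟩
      exact ⟨i + z, h _, by rw [h]; congr 1; ring⟩
    · rintro ⟨i, rfl, rfl⟩
      exact ⟨i - z, by rw [h]; simp, by rw [h]; congr 1; ring⟩
  rw [key, key]

variable [NeZero v]

theorem cycle_injective (t : ZMod v) : Function.Injective (W.cycle t) := by
  intro i j h
  have := W.modEq_of_eq _ _ (add_right_cancel h)
  rw [← ZMod.natCast_eq_natCast_iff] at this
  simpa using this

theorem cycle_succ (t : ZMod v) (i : ZMod v) : W.cycle t (i + 1) = W.walk (i.val + 1) + t := by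
  rw [← W.cycle_natCast]
  simp

theorem cycle_succ_sub (t : ZMod v) (i : ZMod v) :
    W.cycle t (i + 1) - W.cycle t i = W.step i.val := by
  rw [cycle_succ, cycle, step]
  ring

theorem closedTrail_cycle_add_shift (t : ZMod v) (q : ℕ) :
    closedTrail (W.cycle (t + q * W.shift)) = closedTrail (W.cycle t) := by
  apply closedTrail_eq_of_forall ((q * W.period : ℕ) : ZMod v)
  intro i
  obtain ⟨x, rfl⟩ : ∃ x : ℕ, (x : ZMod v) = i := ⟨i.val, by simp⟩
  rw [← Nat.cast_add, cycle_natCast, cycle_natCast, walk_add_mul_period]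
  ring

/-- Used when two translates of one walk share an edge: equal steps force indices congruent modulo
the period, and then the translations differ by a multiple of the shift, which preserves the cycle.
-/
theorem closedTrail_cycle_eq_of_modEq {t t' : ZMod v} {x x' : ℕ} (hx : x ≡ x' [MOD W.period])
    (h : W.walk x + t = W.walk x' + t') : closedTrail (W.cycle t) = closedTrail (W.cycle t') := by
  wlog hle : x ≤ x' generalizing t t' x x'
  · exact (this hx.symm h.symm (by omega)).symm
  obtain ⟨q, hq⟩ := (Nat.modEq_iff_dvd' hle).1 hx
  obtain rfl : x' = x + q * W.period := by rw [mul_comm, ← hq]; omega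
  rw [walk_add_mul_period] at h
  rw [← W.closedTrail_cycle_add_shift t' q]
  congr 2
  linear_combination h

end SymmetricHamiltonianWalk

/-- Coverage alone suffices because of the count: the signed steps over one period are exactly as
many as the nonmultiples of `m`. Being onto these, they never leave them and never repeat, so an
edge determines the base walk, the index modulo the period and hence the translate. -/
theorem exists_factorization_of_walks {m n : ℕ} (hm : 0 < m) (hn : 0 < n) (hv : 3 ≤ m * n)
    {ι : Type*} [Fintype ι] (W : ι → SymmetricHamiltonianWalk (m * n))
    (hcard : 2 * ∑ j, (W j).period = m * n - n)
    (hcover : ∀ d : ZMod (m * n), d ∉ AddSubgroup.zmultiples (m : ZMod (m * n)) →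
      ∃ j x, (W j).step x = d ∨ (W j).step x = -d) :
    ∃ 𝓕 : Set (Set (SimpleGraph (ZMod (m * n)))),
      IsHamiltonianTwoFactorization (multipartiteGraph m n) 𝓕 ∧ IsRegularUnderTranslation 𝓕 := by
  classical
  have : NeZero (m * n) := ⟨by omega⟩
  set f : (Σ j, Fin (W j).period) × Bool → ZMod (m * n) := fun p =>
    if p.2 then (W p.1.1).step p.1.2 else -(W p.1.1).step p.1.2 with hf
  set S : Finset (ZMod (m * n)) := Finset.univ.filter fun x =>
    x ∉ AddSubgroup.zmultiples (m : ZMod (m * n)) with hS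
  have hScard := card_not_mem_zmultiples hm hn S (by simp [hS])
  have hfcard : Fintype.card ((Σ j, Fin (W j).period) × Bool) = S.card := by
    rw [hScard, ← hcard]
    simp [mul_comm]
  have hmod : ∀ j x, (W j).step x = f (⟨j, ⟨x % (W j).period, Nat.mod_lt _ (W j).period_pos⟩⟩, true) :=
    fun j x => by simp [hf, (W j).step_mod_period]
  have hmod' : ∀ j x, -(W j).step x = f (⟨j, ⟨x % (W j).period, Nat.mod_lt _ (W j).period_pos⟩⟩, false) :=
    fun j x => by simp [hf, (W j).step_mod_period]
  have hsub : S ⊆ Finset.univ.image f := by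
    intro d hd
    obtain ⟨j, x, h | h⟩ := hcover d (Finset.mem_filter.1 hd).2
    · exact Finset.mem_image.2 ⟨_, Finset.mem_univ _, by rw [← hmod, h]⟩
    · exact Finset.mem_image.2 ⟨_, Finset.mem_univ _, by rw [← hmod', h, neg_neg]⟩
  have hle : (Finset.univ.image f).card ≤ S.card := by
    rw [← hfcard]
    exact Finset.card_image_le
  have hSf : S = Finset.univ.image f := Finset.eq_of_subset_of_card_le hsub hle
  have hinj : Function.Injective f := by
    rw [← Set.injOn_univ, ← Finset.coe_univ]
    apply Finset.card_image_iff.1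
    rw [← hSf, ← hfcard, Finset.card_univ]
  have hstep : ∀ j x, (W j).step x ∉ AddSubgroup.zmultiples (m : ZMod (m * n)) := by
    intro j x
    have : (W j).step x ∈ S := by
      rw [hSf, hmod]
      exact Finset.mem_image_of_mem _ (Finset.mem_univ _)
    exact (Finset.mem_filter.1 this).2
  have huniq : ∀ j x j' x', (W j).step x = (W j').step x' →
      ∃ h : j = j', x ≡ x' [MOD (W j).period] := by
    intro j x j' x' h
    rw [hmod, hmod] at h
    have h2 := congrArg Prod.fst (hinj h)
    obtain ⟨rfl, h3⟩ := Sigma.mk.inj h2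
    exact ⟨rfl, by simpa [Nat.ModEq] using h3⟩
  have huniq' : ∀ j x j' x', (W j).step x ≠ -(W j').step x' := by
    intro j x j' x' h
    rw [hmod, hmod'] at h
    simpa using congrArg Prod.snd (hinj h)
  set C : ι → ZMod (m * n) → SimpleGraph (ZMod (m * n)) := fun j t =>
    closedTrail ((W j).cycle t) with hC
  have hadj : ∀ j t i, (multipartiteGraph m n).Adj ((W j).cycle t i) ((W j).cycle t (i + 1)) := by
    intro j t i
    apply SimpleGraph.Adj.symm
    change _ - _ ∉ _
    rw [SymmetricHamiltonianWalk.cycle_succ_sub]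
    exact hstep _ _
  have hcyc : ∀ j t, IsCycleOfLength (multipartiteGraph m n) (m * n) (C j t) := fun j t =>
    ⟨hv, (W j).cycle t, (W j).cycle_injective t, hadj j t, rfl⟩
  have hsame : ∀ j t j' t' x y, (C j t).Adj x y → (C j' t').Adj x y → C j t = C j' t' := by
    intro j t j' t' x y h h'
    rw [hC, closedTrail_adj hv ((W j).cycle_injective t)] at h
    rw [hC, closedTrail_adj hv ((W j').cycle_injective t')] at h'
    obtain ⟨i, h⟩ := h
    obtain ⟨i', h'⟩ := h'
    have e := (W j).cycle_succ_sub t i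
    have e' := (W j').cycle_succ_sub t' i'
    rcases h with ⟨h1, h2⟩ | ⟨h1, h2⟩ <;> rcases h' with ⟨h3, h4⟩ | ⟨h3, h4⟩
    · rw [← h1, ← h2] at e
      rw [← h3, ← h4] at e'
      obtain ⟨rfl, hx⟩ := huniq j i.val j' i'.val (by rw [← e, ← e'])
      exact (W j).closedTrail_cycle_eq_of_modEq hx (h1.symm.trans h3)
    · rw [← h1, ← h2] at e
      rw [← h3, ← h4] at e'
      exact absurd (by rw [← e, ← e', neg_sub]) (huniq' j i.val j' i'.val)
    · rw [← h1, ← h2] at e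
      rw [← h3, ← h4] at e'
      exact absurd (by rw [← e, ← e', neg_sub]) (huniq' j i.val j' i'.val)
    · rw [← h1, ← h2] at e
      rw [← h3, ← h4] at e'
      obtain ⟨rfl, hx⟩ := huniq j i.val j' i'.val (by rw [← e, ← e'])
      exact (W j).closedTrail_cycle_eq_of_modEq hx (h1.symm.trans h3)
  -- Each cycle is hamiltonian, hence a 2-factor by itself.
  refine ⟨{F | ∃ j t, F = {C j t}}, ⟨⟨?_, ?_⟩, ?_⟩, ?_⟩
  · rintro F ⟨j, t, rfl⟩
    refine ⟨?_, fun x => ⟨C j t, ⟨rfl, ?_⟩, fun C' h => h.1⟩⟩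
    · rintro C' rfl
      exact ⟨_, hcyc j t⟩
    · exact closedTrail_support hv (Finite.injective_iff_bijective.1 ((W j).cycle_injective t)) x
  · intro e
    induction e using Sym2.ind with
    | _ x y =>
      intro hxy
      have hex : ∃ j t, (C j t).Adj x y := by
        obtain ⟨j, z, h⟩ := hcover (x - y) hxy
        rcases h with h | h
        · refine ⟨j, y - (W j).walk z, (closedTrail_adj hv ((W j).cycle_injective _) _ _).2
            ⟨(z : ZMod (m * n)), Or.inr ⟨?_, ?_⟩⟩⟩
          · rw [(W j).cycle_natCast]; ring
          · rw [← Nat.cast_one, ← Nat.cast_add, (W j).cycle_natCast]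
            rw [SymmetricHamiltonianWalk.step] at h
            linear_combination -h
        · refine ⟨j, x - (W j).walk z, (closedTrail_adj hv ((W j).cycle_injective _) _ _).2
            ⟨(z : ZMod (m * n)), Or.inl ⟨?_, ?_⟩⟩⟩
          · rw [(W j).cycle_natCast]; ring
          · rw [← Nat.cast_one, ← Nat.cast_add, (W j).cycle_natCast]
            rw [SymmetricHamiltonianWalk.step] at h
            linear_combination -h
      obtain ⟨j, t, h⟩ := hex
      refine ⟨{C j t}, ⟨⟨j, t, rfl⟩, C j t, rfl, h⟩, ?_⟩
      rintro F ⟨⟨j', t', rfl⟩, C', rfl, h'⟩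
      rw [hsame j t j' t' x y h h']
  · rintro F ⟨j, t, rfl⟩ C' rfl
    rw [Nat.card_zmod]
    exact hcyc j t
  · rintro F ⟨j, t, rfl⟩ g
    refine ⟨j, t + g, ?_⟩
    rw [Set.image_singleton, hC, translate_closedTrail]
    simp only [SymmetricHamiltonianWalk.cycle, add_assoc]
    rfl

namespace SymmetricHamiltonianWalk

/-- The walk running through `p 0, …, p (ℓ - 1)` and then through the translates of this sequence
by the multiples of `g`. -/
def ofBase {v ℓ d : ℕ} (hv : v = ℓ * d) (hℓ : 0 < ℓ) (g : ZMod v) (p : ℕ → ZMod v)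
    (hg : (d : ZMod v) * g = 0)
    (H : ∀ a b s s' : ℕ, s < ℓ → s' < ℓ → a * g + p s = b * g + p s' → s = s' ∧ a ≡ b [MOD d]) :
    SymmetricHamiltonianWalk v where
  walk x := (x / ℓ : ℕ) * g + p (x % ℓ)
  period := ℓ
  shift := g
  period_pos := hℓ
  walk_add_period x := by
    rw [Nat.add_div_right _ hℓ, Nat.add_mod_right]
    push_cast
    ring
  walk_add_card x := by
    have h1 : (x + v) / ℓ = x / ℓ + d := by rw [hv, Nat.add_mul_div_left _ _ hℓ]
    have h2 : (x + v) % ℓ = x % ℓ := by rw [hv, Nat.add_mul_mod_self_left]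
    rw [h1, h2]
    push_cast
    rw [add_mul, hg, add_zero]
  modEq_of_eq x y h := by
    obtain ⟨h1, h2⟩ := H _ _ _ _ (Nat.mod_lt _ hℓ) (Nat.mod_lt _ hℓ) h
    rw [← Nat.div_add_mod x ℓ, ← Nat.div_add_mod y ℓ, h1, hv]
    exact (h2.mul_left' ℓ).add_right _

section ofBase

variable {v ℓ d : ℕ} {hv : v = ℓ * d} {hℓ : 0 < ℓ} {g : ZMod v} {p : ℕ → ZMod v}
  {hg : (d : ZMod v) * g = 0}
  {H : ∀ a b s s' : ℕ, s < ℓ → s' < ℓ → a * g + p s = b * g + p s' → s = s' ∧ a ≡ b [MOD d]}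

theorem ofBase_step {s : ℕ} (hs : s + 1 < ℓ) : (ofBase hv hℓ g p hg H).step s = p (s + 1) - p s := by
  simp only [step, ofBase]
  rw [Nat.div_eq_of_lt hs, Nat.div_eq_of_lt (by omega), Nat.mod_eq_of_lt hs,
    Nat.mod_eq_of_lt (by omega : s < ℓ)]
  ring

theorem ofBase_step_last {s : ℕ} (hs : s + 1 = ℓ) :
    (ofBase hv hℓ g p hg H).step s = g + p 0 - p s := by
  simp only [step, ofBase]
  rw [Nat.div_eq_of_lt (by omega : s < ℓ), Nat.mod_eq_of_lt (by omega : s < ℓ), hs,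
    Nat.div_self hℓ, Nat.mod_self]
  push_cast
  ring

end ofBase

end SymmetricHamiltonianWalk

/-! ### The explicit base walks -/

theorem intCast_eq_of_eq_add_mul {v : ℕ} {N : ℤ} (hv : (v : ℤ) = 2 * N) {X Y : ℤ} (q : ℤ)
    (h : X = Y + q * (2 * N)) : (X : ZMod v) = Y := by
  rw [ZMod.intCast_eq_intCast_iff_dvd_sub, hv]
  exact ⟨-q, by rw [h]; ring⟩

theorem dvd_sub_of_intCast_eq {v : ℕ} {X Y : ℤ} (h : (X : ZMod v) = Y) : (v : ℤ) ∣ X - Y :=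
  (ZMod.intCast_eq_intCast_iff_dvd_sub _ _ _).1 h.symm

theorem natModEq_of_dvd_mul {d a b : ℕ} {u : ℤ} (hu : IsCoprime (d : ℤ) u)
    (h : (d : ℤ) ∣ (a - b) * u) : a ≡ b [MOD d] := by
  exact (Nat.modEq_iff_dvd.2 (hu.dvd_of_dvd_mul_right h)).symm

/-- The vertices of the first period of the base walks of period `m = 4 * t + 1`, where
`n = 4 * B + 2`: a zigzag modulo `m`. -/
def zigzag (t B j s : ℕ) : ℤ :=
  2 * (if Even s then (4 * t + 1 : ℤ) - s else s + 1) +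
  2 * (4 * t + 1) * (if s ≤ 2 * t then (if Even s then 0 else -(j : ℤ)) else
    j - B - 1 + (if Even s then (if j = 0 then 1 else (j : ℤ)) else 0)) +
  (if j = 0 ∧ 2 * t < s ∧ ¬ Even s then ((4 * t + 1) * (2 * B + 1) : ℤ) else 0)

theorem zigzag_even_of_le {t B j i : ℕ} (h : i ≤ t) :
    zigzag t B j (2 * i) = 2 * (4 * t + 1 - 2 * i) := by
  simp [zigzag, h]

theorem zigzag_odd_of_lt {t B j i : ℕ} (h : i < t) :
    zigzag t B j (2 * i + 1) = 2 * (2 * i + 2) - 2 * (4 * t + 1) * j := by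
  have : ¬ 2 * t < 2 * i + 1 := by omega
  simp [zigzag, this, show 2 * i + 1 ≤ 2 * t by omega]
  ring

theorem zigzag_even_of_lt {t B j i : ℕ} (h : t < i) :
    zigzag t B j (2 * i) = 2 * (4 * t + 1 - 2 * i) +
      2 * (4 * t + 1) * (j - B - 1 + if j = 0 then 1 else (j : ℤ)) := by
  simp [zigzag, show ¬ i ≤ t by omega]

theorem zigzag_odd_of_le {t B j i : ℕ} (h : t ≤ i) :
    zigzag t B j (2 * i + 1) = 2 * (2 * i + 2) + 2 * (4 * t + 1) * (j - B - 1) +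
      if j = 0 then ((4 * t + 1) * (2 * B + 1) : ℤ) else 0 := by
  simp [zigzag, show ¬ 2 * i + 1 ≤ 2 * t by omega, show 2 * t < 2 * i + 1 by omega]
  ring

theorem exists_zigzag_eq (t B j s : ℕ) : ∃ r : ℤ, zigzag t B j s =
    2 * (if Even s then (4 * t + 1 : ℤ) - s else s + 1) + (4 * t + 1) * r := by
  refine ⟨2 * (if s ≤ 2 * t then (if Even s then 0 else -(j : ℤ)) else
    j - B - 1 + (if Even s then (if j = 0 then 1 else (j : ℤ)) else 0)) +
    (if j = 0 ∧ 2 * t < s ∧ ¬ Even s then (2 * B + 1 : ℤ) else 0), ?_⟩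
  rw [zigzag]
  split_ifs <;> ring

/-- Modulo `m = 4t + 1`, the halved values are `m - s` for even `s`, running through the odd numbers
from `m` down to 1, and `s + 1` for odd `s`, running through the even numbers from 2 to `m - 1`.
Thus each residue occurs once, and 2 is invertible. -/
theorem eq_of_zigzag {t B j s s' : ℕ} (hs : s < 4 * t + 1) (hs' : s' < 4 * t + 1)
    (h : (4 * t + 1 : ℤ) ∣ zigzag t B j s - zigzag t B j s') : s = s' := by
  obtain ⟨r, hr⟩ := exists_zigzag_eq t B j s
  obtain ⟨r', hr'⟩ := exists_zigzag_eq t B j s'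
  set q : ℤ := if Even s then (4 * t + 1 : ℤ) - s else s + 1 with hq
  set q' : ℤ := if Even s' then (4 * t + 1 : ℤ) - s' else s' + 1 with hq'
  have h1 : (4 * t + 1 : ℤ) ∣ 2 * (q - q') := by
    obtain ⟨w, hw⟩ := h
    exact ⟨w - r + r', by rw [hr, hr'] at hw; linear_combination hw⟩
  have hco : IsCoprime (4 * t + 1 : ℤ) 2 := ⟨1, -(2 * t), by ring⟩
  obtain ⟨w, hw⟩ := hco.dvd_of_dvd_mul_left h1
  have hw0 : q = q' := by
    have b1 : q - q' < 4 * t + 1 := by simp only [hq, hq']; split_ifs <;> omega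
    have b2 : -(4 * t + 1 : ℤ) < q - q' := by simp only [hq, hq']; split_ifs <;> omega
    rw [hw] at b1 b2
    have : w = 0 := by
      have : w < 1 := by nlinarith
      have : -1 < w := by nlinarith
      omega
    rw [this] at hw
    linarith
  simp only [hq, hq'] at hw0
  rcases Nat.even_or_odd' s with ⟨i, rfl | rfl⟩ <;> rcases Nat.even_or_odd' s' with ⟨i', rfl | rfl⟩ <;>
    simp at hw0 <;> omega

theorem isCoprime_two_mul_odd (B : ℤ) : IsCoprime (2 * (2 * B + 1)) (2 * B - 1) :=
  IsCoprime.mul_left ⟨-(B - 1), 1, by ring⟩ ⟨1 - B, B, by ring⟩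

theorem isCoprime_odd_two (c : ℤ) : IsCoprime (2 * c + 1) 2 := ⟨1, -c, by ring⟩

section Walks

variable {m n t B : ℕ}

theorem cast_card (hm : m = 4 * t + 1) (hn : n = 4 * B + 2) :
    ((m * n : ℕ) : ℤ) = 2 * ((4 * t + 1) * (2 * B + 1)) := by
  subst hm hn
  push_cast
  ring

/-- The shift `m * (2 * B - 1)` generates the multiples of `m`, as `2 * B - 1` is coprime to `n`;
the first period meets each coset of them once. The shift is also odd, which makes the closing step
of the period an odd difference. -/
def zigzagWalk (hm : m = 4 * t + 1) (hn : n = 4 * B + 2) (j : ℕ) :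
    SymmetricHamiltonianWalk (m * n) :=
  .ofBase rfl (by omega) (((4 * t + 1) * (2 * B - 1) : ℤ) : ZMod (m * n))
    (fun s => (zigzag t B j s : ZMod (m * n)))
    (by
      rw [← Int.cast_natCast n, ← Int.cast_mul, ← Int.cast_zero]
      apply intCast_eq_of_eq_add_mul (cast_card hm hn) (2 * B - 1)
      rw [hn]; push_cast; ring)
    (by
      intro a b s s' hs hs' h
      have h1 := dvd_sub_of_intCast_eq (X := a * ((4 * t + 1) * (2 * B - 1)) + zigzag t B j s)
        (Y := b * ((4 * t + 1) * (2 * B - 1)) + zigzag t B j s')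
        (by push_cast at h ⊢; exact h)
      rw [cast_card hm hn] at h1
      have hss : s = s' := by
        subst hm
        apply eq_of_zigzag hs hs' (B := B) (j := j)
        obtain ⟨w, hw⟩ := h1
        exact ⟨2 * (2 * B + 1) * w - (a - b) * (2 * B - 1), by linear_combination hw⟩
      refine ⟨hss, ?_⟩
      subst hss
      refine natModEq_of_dvd_mul (u := 2 * B - 1) ?_ ?_
      · have := isCoprime_two_mul_odd B
        rw [hn]; push_cast
        convert this using 1
        ring
      · obtain ⟨w, hw⟩ := h1
        refine ⟨w, ?_⟩
        have h0 : (4 * t + 1 : ℤ) ≠ 0 := by positivity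
        apply mul_left_cancel₀ h0
        rw [hn]; push_cast
        linear_combination hw)

theorem zigzagWalk_step (hm : m = 4 * t + 1) (hn : n = 4 * B + 2) (j : ℕ) {s : ℕ}
    (hs : s < 4 * t) : (zigzagWalk hm hn j).step s =
      ((zigzag t B j (s + 1) - zigzag t B j s : ℤ) : ZMod (m * n)) := by
  rw [zigzagWalk, SymmetricHamiltonianWalk.ofBase_step (by omega)]
  push_cast
  rfl

theorem zigzagWalk_step_last (hm : m = 4 * t + 1) (hn : n = 4 * B + 2) (j : ℕ) :
    (zigzagWalk hm hn j).step (4 * t) =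
      (((4 * t + 1) * (2 * B - 1) + zigzag t B j 0 - zigzag t B j (4 * t) : ℤ) : ZMod (m * n)) := by
  rw [zigzagWalk, SymmetricHamiltonianWalk.ofBase_step_last (by omega)]
  push_cast
  rfl

/-- The walk with alternating odd steps `N + 2y` and `N + 2(u - y)`, where `N = mn/2`. -/
def pairWalk (hm : m = 4 * t + 1) (hn : n = 4 * B + 2) (u y : ℤ)
    (hu : IsCoprime ((4 * t + 1) * (2 * B + 1) : ℤ) u) : SymmetricHamiltonianWalk (m * n) :=
  .ofBase (ℓ := 2) (d := (4 * t + 1) * (2 * B + 1)) (by subst hm hn; ring) (by omega)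
    ((2 * u : ℤ) : ZMod (m * n))
    (fun s => ((s * ((4 * t + 1) * (2 * B + 1) + 2 * y) : ℤ) : ZMod (m * n)))
    (by
      rw [← Int.cast_natCast, ← Int.cast_mul, ← Int.cast_zero]
      apply intCast_eq_of_eq_add_mul (cast_card hm hn) u
      push_cast; ring)
    (by
      intro a b s s' hs hs' h
      have h1 := dvd_sub_of_intCast_eq (X := a * (2 * u) + s * ((4 * t + 1) * (2 * B + 1) + 2 * y))
        (Y := b * (2 * u) + s' * ((4 * t + 1) * (2 * B + 1) + 2 * y))
        (by push_cast at h ⊢; exact h)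
      rw [cast_card hm hn] at h1
      have hss : s = s' := by
        obtain ⟨w, hw⟩ := h1
        have h2 : (2 : ℤ) ∣ s - s' := ⟨(4 * t + 1) * (2 * B + 1) * w - (a - b) * u -
          (s - s') * (4 * t * B + 2 * t + B + y), by linear_combination hw⟩
        omega
      refine ⟨hss, ?_⟩
      subst hss
      refine natModEq_of_dvd_mul (u := u) (by push_cast; exact hu) ?_
      obtain ⟨w, hw⟩ := h1
      exact ⟨w, by push_cast; linarith⟩)

theorem pairWalk_step_zero (hm : m = 4 * t + 1) (hn : n = 4 * B + 2) (u y : ℤ)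
    (hu : IsCoprime ((4 * t + 1) * (2 * B + 1) : ℤ) u) :
    (pairWalk hm hn u y hu).step 0 = (((4 * t + 1) * (2 * B + 1) + 2 * y : ℤ) : ZMod (m * n)) := by
  rw [pairWalk, SymmetricHamiltonianWalk.ofBase_step (by omega)]
  push_cast
  ring

theorem pairWalk_step_one (hm : m = 4 * t + 1) (hn : n = 4 * B + 2) (u y : ℤ)
    (hu : IsCoprime ((4 * t + 1) * (2 * B + 1) : ℤ) u) :
    (pairWalk hm hn u y hu).step 1 =
      (((4 * t + 1) * (2 * B + 1) + 2 * (u - y) : ℤ) : ZMod (m * n)) := by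
  rw [pairWalk, SymmetricHamiltonianWalk.ofBase_step_last rfl]
  have := intCast_eq_of_eq_add_mul (cast_card hm hn)
    (X := 2 * u - ((4 * t + 1) * (2 * B + 1) + 2 * y))
    (Y := (4 * t + 1) * (2 * B + 1) + 2 * (u - y)) (-1) (by ring)
  rw [← this]
  push_cast
  ring

/-- As `N` is odd, `N + 2` is coprime to `2 * N`, so its multiples already form a hamiltonian cycle.
-/
def singleWalk (hm : m = 4 * t + 1) (hn : n = 4 * B + 2) : SymmetricHamiltonianWalk (m * n) :=
  .ofBase (ℓ := 1) (d := m * n) (by ring) (by omega)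
    (((4 * t + 1) * (2 * B + 1) + 2 : ℤ) : ZMod (m * n)) (fun _ => 0) (by simp)
    (by
      intro a b s s' hs hs' h
      refine ⟨by omega, ?_⟩
      have h1 := dvd_sub_of_intCast_eq (X := a * ((4 * t + 1) * (2 * B + 1) + 2))
        (Y := b * ((4 * t + 1) * (2 * B + 1) + 2)) (by push_cast at h ⊢; simpa using h)
      rw [← sub_mul] at h1
      refine natModEq_of_dvd_mul ?_ h1
      rw [cast_card hm hn]
      have ho : (4 * t + 1 : ℤ) * (2 * B + 1) = 2 * (4 * t * B + 2 * t + B) + 1 := by ring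
      rw [ho]
      generalize (4 * t * B + 2 * t + B : ℤ) = c
      exact IsCoprime.mul_left ⟨-(c + 1), 1, by ring⟩ ⟨c + 1, -c, by ring⟩)

theorem singleWalk_step (hm : m = 4 * t + 1) (hn : n = 4 * B + 2) :
    (singleWalk hm hn).step 0 = (((4 * t + 1) * (2 * B + 1) + 2 : ℤ) : ZMod (m * n)) := by
  rw [singleWalk, SymmetricHamiltonianWalk.ofBase_step_last rfl]
  simp

end Walks

/-! ### Every admissible difference is covered -/

section Cover

variable {m n t B : ℕ}

/-- `d` is, up to sign, a step of the walk `W`. -/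
def SymmetricHamiltonianWalk.Covers {v : ℕ} (W : SymmetricHamiltonianWalk v) (d : ZMod v) : Prop :=
  ∃ x, W.step x = d ∨ W.step x = -d

theorem SymmetricHamiltonianWalk.Covers.neg {v : ℕ} {W : SymmetricHamiltonianWalk v} {d : ZMod v}
    (h : W.Covers d) : W.Covers (-d) := by
  obtain ⟨x, h⟩ := h
  exact ⟨x, by rw [neg_neg]; exact h.symm⟩

theorem SymmetricHamiltonianWalk.covers_of_step_eq {v : ℕ} {N : ℤ} (hv : (v : ℤ) = 2 * N)
    {W : SymmetricHamiltonianWalk v} {x : ℕ} {X Y : ℤ} (h : W.step x = X) (q : ℤ)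
    (hXY : X = Y + q * (2 * N) ∨ X = -Y + q * (2 * N)) : W.Covers Y := by
  refine ⟨x, ?_⟩
  rw [h, ← Int.cast_neg]
  exact hXY.imp (intCast_eq_of_eq_add_mul hv q) (intCast_eq_of_eq_add_mul hv q)

theorem SymmetricHamiltonianWalk.Covers.of_cast_eq {v : ℕ} {W : SymmetricHamiltonianWalk v}
    {X Y : ℤ} (h : W.Covers X) (hXY : X = Y) : W.Covers Y := hXY ▸ h

open SymmetricHamiltonianWalk

theorem zigzagWalk_covers_first (hm : m = 4 * t + 1) (hn : n = 4 * B + 2) (j w : ℕ)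
    (hw : w < 2 * t) :
    (zigzagWalk hm hn j).Covers
      ((2 * (2 * w + 1 + (4 * t + 1) * j) : ℤ) : ZMod (m * n)) := by
  -- Before the corrections by multiples of `m`, the step at `s` is `±2 * (2 * s + 2 - m)`. It is
  -- `±2 * (2 * w + 1)` exactly at `s = 2 * t - 1 - w` and `s = 2 * t + w`, so each `w` occurs once
  -- in each half of the period.
  have hst := zigzagWalk_step hm hn j (s := 2 * t - w - 1) (by omega)
  refine covers_of_step_eq (cast_card hm hn) hst 0 ?_
  rcases Nat.even_or_odd' (2 * t - w - 1) with ⟨i, hi | hi⟩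
  · right
    rw [hi, zigzag_odd_of_lt (by omega), zigzag_even_of_le (by omega)]
    have : (w : ℤ) = 2 * t - 1 - 2 * i := by omega
    rw [this]; ring
  · left
    rw [hi, show 2 * i + 1 + 1 = 2 * (i + 1) by ring, zigzag_odd_of_lt (by omega),
      zigzag_even_of_le (by omega)]
    have : (w : ℤ) = 2 * t - 2 - 2 * i := by omega
    rw [this]; push_cast; ring

/-- This is the step from the first half of the zigzag to the second, where the multiple of `m`
jumps. It plays the part of `w = 0` in the second half. -/
theorem zigzagWalk_covers_middle (hm : m = 4 * t + 1) (hn : n = 4 * B + 2) (ht : 0 < t) (j : ℕ) :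
    (zigzagWalk hm hn j).Covers
      (((if j = 0 then ((4 * t + 1) * (2 * B + 1) : ℤ) else 0) +
        2 * (1 + (4 * t + 1) * (j - B - 1)) : ℤ) : ZMod (m * n)) := by
  have hst := zigzagWalk_step hm hn j (s := 2 * t) (by omega)
  refine covers_of_step_eq (cast_card hm hn) hst 0 (Or.inl ?_)
  rw [zigzag_odd_of_le le_rfl, zigzag_even_of_le le_rfl]
  ring

theorem zigzagWalk_covers_second (hm : m = 4 * t + 1) (hn : n = 4 * B + 2) (j w : ℕ)
    (hw0 : 0 < w) (hw : w < 2 * t) :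
    (zigzagWalk hm hn j).Covers
      (((if j = 0 then ((4 * t + 1) * (2 * B + 1) : ℤ) else 0) +
        2 * (2 * w + 1 - (4 * t + 1) * (if j = 0 then 1 else (j : ℤ))) : ℤ) : ZMod (m * n)) := by
  have hst := zigzagWalk_step hm hn j (s := 2 * t + w) (by omega)
  rcases Nat.even_or_odd' (2 * t + w) with ⟨i, hi | hi⟩
  · refine covers_of_step_eq (cast_card hm hn) hst 0 (Or.inl ?_)
    rw [hi, zigzag_odd_of_le (by omega), zigzag_even_of_lt (by omega)]
    have : (w : ℤ) = 2 * i - 2 * t := by omega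
    rw [this]; ring
  · refine covers_of_step_eq (cast_card hm hn) hst 0 (Or.inr ?_)
    rw [hi, show 2 * i + 1 + 1 = 2 * (i + 1) by ring, zigzag_odd_of_le (by omega),
      zigzag_even_of_lt (by omega)]
    have : (w : ℤ) = 2 * i + 1 - 2 * t := by omega
    rw [this]; push_cast; ring

theorem zigzagWalk_covers_last (hm : m = 4 * t + 1) (hn : n = 4 * B + 2) (ht : 0 < t) (j : ℕ) :
    (zigzagWalk hm hn j).Covers
      (((4 * t + 1) * (2 * B + 1) +
        2 * (1 + (4 * t + 1) * (j - B - 1 + if j = 0 then 1 else (j : ℤ))) : ℤ) : ZMod (m * n)) := by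
  have hst := zigzagWalk_step_last hm hn j
  refine covers_of_step_eq (cast_card hm hn) hst 1 (Or.inr ?_)
  rw [show 4 * t = 2 * (2 * t) by ring, zigzag_even_of_lt (by omega)]
  have h0 := zigzag_even_of_le (t := t) (B := B) (j := j) (i := 0) (by omega)
  rw [mul_zero] at h0
  rw [h0]
  push_cast
  ring

theorem pairWalk_covers (hm : m = 4 * t + 1) (hn : n = 4 * B + 2) (u y : ℤ)
    (hu : IsCoprime ((4 * t + 1) * (2 * B + 1) : ℤ) u) {z : ℤ} (q : ℤ)
    (h : z = y + q * ((4 * t + 1) * (2 * B + 1)) ∨ z = u - y + q * ((4 * t + 1) * (2 * B + 1)) ∨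
      z = -(u - y) + q * ((4 * t + 1) * (2 * B + 1))) :
    (pairWalk hm hn u y hu).Covers
      (((4 * t + 1) * (2 * B + 1) + 2 * z : ℤ) : ZMod (m * n)) := by
  rcases h with rfl | rfl | rfl
  · exact covers_of_step_eq (cast_card hm hn) (pairWalk_step_zero hm hn u y hu) (-q)
      (Or.inl (by ring))
  · exact covers_of_step_eq (cast_card hm hn) (pairWalk_step_one hm hn u y hu) (-q)
      (Or.inl (by ring))
  · exact covers_of_step_eq (cast_card hm hn) (pairWalk_step_one hm hn u y hu) (1 + q)
      (Or.inr (by ring))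

theorem isCoprime_half_two (t B : ℤ) : IsCoprime ((4 * t + 1) * (2 * B + 1) : ℤ) 2 := by
  rw [show (4 * t + 1 : ℤ) * (2 * B + 1) = 2 * (4 * t * B + 2 * t + B) + 1 by ring]
  exact isCoprime_odd_two _

theorem isCoprime_half_neg_four (t B : ℤ) :
    IsCoprime ((4 * t + 1) * (2 * B + 1) : ℤ) (-4) := by
  have := ((isCoprime_half_two t B).mul_right (isCoprime_half_two t B)).neg_right
  norm_num at this ⊢
  exact this

/-- The index type of the base walks. -/
abbrev WalkIndex (t B : ℕ) : Type :=
  Fin (B + 1) ⊕ (Fin (t - 1) × Fin (2 * B)) ⊕ Fin B ⊕ Fin ((B - 1) / 2) ⊕ Fin ((B - 1) % 2)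

/-- The walks `zigzagWalk` with `j > 0` have only even steps except the closing one; the extra `N`
in the zigzag for `j = 0` makes all of its second half odd. What they leave are odd differences `N +
2 * z`. The walks with `u = 2` and index `p` join `w = 2 * i + 1` to `w = 2 * i + 2` at the same
`l`, up to sign. Those with `u = -4` serve `w = 2 * t - 1`, where `z = -2 + m * (l + 1)`, joining
`l` to `-l - 2`. The last pairs serve `w = 0`, joining `l` to `-l`; for even `B` the value `l = 0`
is its own partner and needs `singleWalk`. -/
def baseWalk (hm : m = 4 * t + 1) (hn : n = 4 * B + 2) :
    WalkIndex t B → SymmetricHamiltonianWalk (m * n)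
  | .inl j => zigzagWalk hm hn j
  | .inr (.inl p) => pairWalk hm hn 2 (4 * (p.1 : ℕ) + 5 + (4 * t + 1) * (p.2 : ℕ))
      (isCoprime_half_two t B)
  | .inr (.inr (.inl i)) => pairWalk hm hn (-4) (-2 + (4 * t + 1) * ((i : ℕ) + 1))
      (isCoprime_half_neg_four t B)
  | .inr (.inr (.inr (.inl i))) => pairWalk hm hn 2 (1 + (4 * t + 1) * (B - 2 - 2 * (i : ℕ)))
      (isCoprime_half_two t B)
  | .inr (.inr (.inr (.inr _))) => singleWalk hm hn

theorem sum_period_baseWalk (hm : m = 4 * t + 1) (hn : n = 4 * B + 2) (ht : 0 < t) (hB : 0 < B) :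
    2 * ∑ j, (baseWalk hm hn j).period = m * n - n := by
  simp only [Fintype.sum_sum_type]
  have h1 : ∀ j : Fin (B + 1), (baseWalk hm hn (.inl j)).period = m := fun _ => rfl
  have h2 : ∀ p, (baseWalk hm hn (.inr (.inl p))).period = 2 := fun _ => rfl
  have h3 : ∀ p, (baseWalk hm hn (.inr (.inr (.inl p)))).period = 2 := fun _ => rfl
  have h4 : ∀ p, (baseWalk hm hn (.inr (.inr (.inr (.inl p))))).period = 2 := fun _ => rfl
  have h5 : ∀ p, (baseWalk hm hn (.inr (.inr (.inr (.inr p))))).period = 1 := fun _ => rfl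
  simp only [h1, h2, h3, h4, h5, Finset.sum_const, Finset.card_univ, Fintype.card_fin,
    Fintype.card_prod, smul_eq_mul]
  obtain ⟨t, rfl⟩ : ∃ t', t = t' + 1 := ⟨t - 1, by omega⟩
  obtain ⟨b, rfl⟩ : ∃ b, B = b + 1 := ⟨B - 1, by omega⟩
  have hb := Nat.div_add_mod b 2
  simp only [Nat.add_sub_cancel]
  have hmn : m * n - n = (4 * t + 4) * n := by
    rw [hm, show 4 * (t + 1) + 1 = (4 * t + 4) + 1 by ring, add_mul _ 1 n, one_mul,
      Nat.add_sub_cancel]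
  rw [hmn, hn, hm]
  generalize b / 2 = x at *
  generalize b % 2 = y at *
  subst hb
  ring

theorem baseWalk_covers_even (hm : m = 4 * t + 1) (hn : n = 4 * B + 2) (ht : 0 < t)
    {w : ℕ} (hw : w < 2 * t) {l : ℤ} (hl : -B ≤ l) (hl' : l ≤ B) :
    ∃ j, (baseWalk hm hn j).Covers ((2 * (2 * w + 1 + (4 * t + 1) * l) : ℤ) : ZMod (m * n)) := by
  -- Nonnegative `l = j` comes from the first half of walk `j`; negative `l` from the second half of
  -- walk `-l`, or, when `w = 0`, from the middle step of walk `l + B + 1`.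
  by_cases h0 : 0 ≤ l
  · lift l to ℕ using h0
    exact ⟨.inl ⟨l, by omega⟩, zigzagWalk_covers_first hm hn l w hw⟩
  rcases Nat.eq_zero_or_pos w with rfl | hw0
  · obtain ⟨j, hj⟩ : ∃ j : ℕ, (j : ℤ) = l + B + 1 := ⟨(l + B + 1).toNat, by omega⟩
    have := zigzagWalk_covers_middle hm hn ht j
    rw [if_neg (by omega), hj] at this
    exact ⟨.inl ⟨j, by omega⟩, this.of_cast_eq (by push_cast; ring)⟩
  · obtain ⟨j, hj⟩ : ∃ j : ℕ, (j : ℤ) = -l := ⟨(-l).toNat, by omega⟩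
    have := zigzagWalk_covers_second hm hn j w hw0 hw
    rw [if_neg (by omega), if_neg (by omega), hj] at this
    exact ⟨.inl ⟨j, by omega⟩, this.of_cast_eq (by ring)⟩

theorem baseWalk_covers_odd_one (hm : m = 4 * t + 1) (hn : n = 4 * B + 2) (ht : 0 < t)
    (hB : 0 < B) {l : ℤ} (hl : -B ≤ l) (hl' : l ≤ B) :
    ∃ j, (baseWalk hm hn j).Covers
      (((4 * t + 1) * (2 * B + 1) + 2 * (1 + (4 * t + 1) * l) : ℤ) : ZMod (m * n)) := by
  by_cases h1 : l = B
  · subst h1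
    refine ⟨.inl ⟨0, by omega⟩, ?_⟩
    have := zigzagWalk_covers_middle hm hn ht 0
    rw [if_pos rfl] at this
    rwa [intCast_eq_of_eq_add_mul (cast_card hm hn) 1]
    push_cast
    ring
  by_cases h2 : l = -B
  · subst h2
    refine ⟨.inl ⟨0, by omega⟩, ?_⟩
    have := zigzagWalk_covers_last hm hn ht 0
    rw [if_pos rfl] at this
    exact this.of_cast_eq (by push_cast; ring)
  -- The closing step of walk `c > 0` has `l = 2 * c - B - 1`. The values left have the parity of
  -- `B` and are symmetric about 0.
  rcases Int.even_or_odd' (l + B + 1) with ⟨c, hc | hc⟩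
  · lift c to ℕ using by omega
    have := zigzagWalk_covers_last hm hn ht c
    rw [if_neg (by omega)] at this
    refine ⟨.inl ⟨c, by omega⟩, this.of_cast_eq ?_⟩
    rw [show l = 2 * c - B - 1 by omega]
    ring
  rcases lt_trichotomy l 0 with h0 | h0 | h0
  · obtain ⟨i, hi⟩ : ∃ i : ℕ, (i : ℤ) = (B - 2 + l) / 2 := ⟨((B - 2 + l) / 2).toNat, by omega⟩
    refine ⟨.inr (.inr (.inr (.inl ⟨i, by omega⟩))), ?_⟩
    refine pairWalk_covers hm hn _ _ (isCoprime_half_two t B) 0 (Or.inr (Or.inl ?_))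
    have hl2 : l = 2 * i + 2 - B := by omega
    dsimp only
    linear_combination (4 * t + 1 : ℤ) * hl2
  · subst h0
    refine ⟨.inr (.inr (.inr (.inr ⟨0, by omega⟩))), ?_⟩
    refine covers_of_step_eq (cast_card hm hn) (singleWalk_step hm hn) 0 (Or.inl ?_)
    ring
  · obtain ⟨i, hi⟩ : ∃ i : ℕ, (i : ℤ) = (B - 2 - l) / 2 := ⟨((B - 2 - l) / 2).toNat, by omega⟩
    refine ⟨.inr (.inr (.inr (.inl ⟨i, by omega⟩))), ?_⟩
    refine pairWalk_covers hm hn _ _ (isCoprime_half_two t B) 0 (Or.inl ?_)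
    have hl2 : l = B - 2 - 2 * i := by omega
    dsimp only
    linear_combination (4 * t + 1 : ℤ) * hl2

theorem baseWalk_covers_odd (hm : m = 4 * t + 1) (hn : n = 4 * B + 2)
    (hB : 0 < B) {w : ℕ} (hw0 : 0 < w) (hw : w < 2 * t) {l : ℤ} (hl : -B ≤ l) (hl' : l ≤ B) :
    ∃ j, (baseWalk hm hn j).Covers
      (((4 * t + 1) * (2 * B + 1) + 2 * (2 * w + 1 + (4 * t + 1) * l) : ℤ) : ZMod (m * n)) := by
  by_cases h1 : l = -1
  · subst h1
    refine ⟨.inl ⟨0, by omega⟩, ?_⟩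
    have := zigzagWalk_covers_second hm hn 0 w hw0 hw
    rw [if_pos rfl, if_pos rfl] at this
    exact this.of_cast_eq (by ring)
  by_cases h2 : w = 2 * t - 1
  · have hwz : (w : ℤ) = 2 * t - 1 := by omega
    rw [hwz]
    -- Modulo `2 * B + 1` this is `-(B - 1) - 2`, the partner of `l = B - 1`.
    by_cases h3 : l = B
    · obtain ⟨b, hb⟩ : ∃ b : ℕ, B = b + 1 := ⟨B - 1, by omega⟩
      have hb' : (B : ℤ) = b + 1 := by omega
      refine ⟨.inr (.inr (.inl ⟨b, by omega⟩)), ?_⟩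
      refine pairWalk_covers hm hn _ _ (isCoprime_half_neg_four t B) 1 (Or.inr (Or.inl ?_))
      dsimp only
      linear_combination (4 * t + 1 : ℤ) * (h3 - hb')
    by_cases h4 : 0 ≤ l
    · lift l to ℕ using h4
      refine ⟨.inr (.inr (.inl ⟨l, by omega⟩)), ?_⟩
      refine pairWalk_covers hm hn _ _ (isCoprime_half_neg_four t B) 0 (Or.inl ?_)
      push_cast
      ring
    · obtain ⟨i, hi⟩ : ∃ i : ℕ, (i : ℤ) = -l - 2 := ⟨(-l - 2).toNat, by omega⟩
      refine ⟨.inr (.inr (.inl ⟨i, by omega⟩)), ?_⟩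
      refine pairWalk_covers hm hn _ _ (isCoprime_half_neg_four t B) 0 (Or.inr (Or.inl ?_))
      dsimp only
      linear_combination (4 * t + 1 : ℤ) * hi
  -- The residue `2 * B` modulo `2 * B + 1` is `l = -1`, already excluded; hence `c < 2 * B`.
  · obtain ⟨c, q, hc, hq⟩ : ∃ (c : ℕ) (q : ℤ), c < 2 * B ∧ l = c + q * (2 * B + 1) := by
      by_cases h4 : 0 ≤ l
      · exact ⟨l.toNat, 0, by omega, by omega⟩
      · exact ⟨(l + (2 * B + 1)).toNat, -1, by omega, by omega⟩
    rcases Nat.even_or_odd' (w - 1) with ⟨i, hi | hi⟩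
    · refine ⟨.inr (.inl (⟨i, by omega⟩, ⟨c, hc⟩)), ?_⟩
      refine pairWalk_covers hm hn _ _ (isCoprime_half_two t B) q (Or.inr (Or.inr ?_))
      rw [hq, show (w : ℤ) = 2 * i + 1 by omega]
      ring
    · refine ⟨.inr (.inl (⟨i, by omega⟩, ⟨c, hc⟩)), ?_⟩
      refine pairWalk_covers hm hn _ _ (isCoprime_half_two t B) q (Or.inl ?_)
      rw [hq, show (w : ℤ) = 2 * i + 2 by omega]
      ring

/-- An integer not divisible by `4t + 1` is, up to sign and modulo `(4t + 1)(2B + 1)`, of the form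
`o + (4t + 1)l` with `o < 4t + 1` odd and `|l| ≤ B`. -/
theorem exists_odd_residue (t B : ℕ) {y : ℤ} (hy : ¬ (4 * t + 1 : ℤ) ∣ y) :
    ∃ (w : ℕ) (l q : ℤ), w < 2 * t ∧ -B ≤ l ∧ l ≤ B ∧
      (y = 2 * w + 1 + (4 * t + 1) * l + q * ((4 * t + 1) * (2 * B + 1)) ∨
        y = -(2 * w + 1 + (4 * t + 1) * l) + q * ((4 * t + 1) * (2 * B + 1))) := by
  have hred : ∀ c : ℤ, ∃ l q : ℤ, -B ≤ l ∧ l ≤ B ∧ c = l + q * (2 * B + 1) := fun c => by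
    have h1 := Int.emod_add_mul_ediv (c + B) (2 * B + 1)
    have h2 := Int.emod_nonneg (c + B) (show (2 * B + 1 : ℤ) ≠ 0 by omega)
    have h3 := Int.emod_lt_of_pos (c + B) (show (0 : ℤ) < 2 * B + 1 by omega)
    exact ⟨(c + B) % (2 * B + 1) - B, (c + B) / (2 * B + 1), by omega, by omega,
      by linear_combination -h1⟩
  have h1 := Int.emod_add_mul_ediv y (4 * t + 1)
  have h2 := Int.emod_nonneg y (show (4 * t + 1 : ℤ) ≠ 0 by omega)
  have h3 := Int.emod_lt_of_pos y (show (0 : ℤ) < 4 * t + 1 by omega)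
  have h4 : y % (4 * t + 1) ≠ 0 := fun h => hy (Int.dvd_of_emod_eq_zero h)
  generalize y % (4 * t + 1) = r at *
  generalize y / (4 * t + 1) = c at *
  rcases Int.even_or_odd' r with ⟨a, rfl | rfl⟩
  -- For the even residue `r = 2 * a` the sign is changed: `-y = (m - 2 * a) + m * (-c - 1)`, with
  -- `m - 2 * a = 2 * (2 * t - a) + 1`.
  · obtain ⟨l, q, hl, hl', hc⟩ := hred (-c - 1)
    refine ⟨(2 * t - a).toNat, l, -q, by omega, hl, hl', Or.inr ?_⟩
    rw [Int.toNat_of_nonneg (by omega), ← h1, show c = -1 - (-c - 1) by ring, hc]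
    ring
  · obtain ⟨l, q, hl, hl', hc⟩ := hred c
    refine ⟨a.toNat, l, q, by omega, hl, hl', Or.inl ?_⟩
    rw [Int.toNat_of_nonneg (by omega), ← h1, hc]
    ring

theorem baseWalk_covers (hm : m = 4 * t + 1) (hn : n = 4 * B + 2) (ht : 0 < t) (hB : 0 < B)
    (d : ZMod (m * n)) (hd : d ∉ AddSubgroup.zmultiples (m : ZMod (m * n))) :
    ∃ j, (baseWalk hm hn j).Covers d := by
  obtain ⟨z, rfl⟩ := ZMod.intCast_surjective d
  have hmz : ¬ (4 * t + 1 : ℤ) ∣ z := by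
    rintro ⟨a, rfl⟩
    exact hd ⟨a, by subst hm; push_cast; simp only [zsmul_eq_mul]; ring⟩
  have hcc := cast_card hm hn
  obtain ⟨y, hy⟩ : ∃ y : ℤ, z = 2 * y ∨ z = (4 * t + 1) * (2 * B + 1) + 2 * y := by
    rcases Int.even_or_odd' z with ⟨a, ha | ha⟩
    · exact ⟨a, Or.inl ha⟩
    · exact ⟨a - (4 * t * B + 2 * t + B), Or.inr (by rw [ha]; ring)⟩
  have hmy : ¬ (4 * t + 1 : ℤ) ∣ y := by
    rintro ⟨a, rfl⟩
    rcases hy with rfl | rfl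
    · exact hmz ⟨2 * a, by ring⟩
    · exact hmz ⟨2 * B + 1 + 2 * a, by ring⟩
  obtain ⟨w, l, q, hw, hl, hl', hyw⟩ := exists_odd_residue t B hmy
  have heven := baseWalk_covers_even hm hn ht hw hl hl'
  have hodd : ∃ j, (baseWalk hm hn j).Covers
      (((4 * t + 1) * (2 * B + 1) + 2 * (2 * w + 1 + (4 * t + 1) * l) : ℤ) : ZMod (m * n)) := by
    rcases Nat.eq_zero_or_pos w with rfl | hw0
    · simpa using baseWalk_covers_odd_one hm hn ht hB hl hl'
    · exact baseWalk_covers_odd hm hn hB hw0 hw hl hl'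
  rcases hy with rfl | rfl <;> rcases hyw with rfl | rfl
  · rwa [intCast_eq_of_eq_add_mul hcc q (Y := 2 * (2 * w + 1 + (4 * t + 1) * l)) (by ring)]
  · rw [intCast_eq_of_eq_add_mul hcc q (Y := -(2 * (2 * w + 1 + (4 * t + 1) * l))) (by ring),
      Int.cast_neg]
    exact heven.imp fun _ h => h.neg
  · rwa [intCast_eq_of_eq_add_mul hcc q
      (Y := (4 * t + 1) * (2 * B + 1) + 2 * (2 * w + 1 + (4 * t + 1) * l)) (by ring)]
  · rw [intCast_eq_of_eq_add_mul hcc (q + 1)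
      (Y := -((4 * t + 1) * (2 * B + 1) + 2 * (2 * w + 1 + (4 * t + 1) * l))) (by ring),
      Int.cast_neg]
    exact hodd.imp fun _ h => h.neg

end Cover

theorem exists_factorization {m n : ℕ} (hm : m ≡ 1 [MOD 4]) (hn : n ≡ 2 [MOD 4]) (hn2 : 2 < n) :
    ∃ 𝓕 : Set (Set (SimpleGraph (ZMod (m * n)))),
      IsHamiltonianTwoFactorization (multipartiteGraph m n) 𝓕 ∧ IsRegularUnderTranslation 𝓕 := by
  have hm' : m % 4 = 1 := hm
  have hn' : n % 4 = 2 := hn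
  rcases eq_or_ne m 1 with rfl | hm1
  -- For `m = 1` the subgroup is everything and there are no edges.
  · refine ⟨∅, ⟨⟨by simp, fun e => ?_⟩, by simp⟩, by simp [IsRegularUnderTranslation]⟩
    induction e using Sym2.ind with
    | _ x y =>
      intro h
      refine absurd ?_ (show x - y ∉ AddSubgroup.zmultiples ((1 : ℕ) : ZMod (1 * n)) from h)
      obtain ⟨z, hz⟩ := ZMod.intCast_surjective (x - y)
      exact ⟨z, by simp [← hz]⟩
  · obtain ⟨t, ht⟩ : ∃ t, m = 4 * t + 1 := ⟨m / 4, by omega⟩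
    obtain ⟨B, hB⟩ : ∃ B, n = 4 * B + 2 := ⟨n / 4, by omega⟩
    refine exists_factorization_of_walks (by omega) (by omega) (by nlinarith) (baseWalk ht hB)
      (sum_period_baseWalk ht hB (by omega) (by omega))
      (baseWalk_covers ht hB (by omega) (by omega))

end CyclicFactorization

theorem mainTheorem5 (m n : ℕ) (hm : Odd m) (hn : n ≡ 2 [MOD 4]) (hn2 : 2 < n) :
    (∃ 𝓕 : Set (Set (SimpleGraph (ZMod (m * n)))),
      CyclicFactorization.IsHamiltonianTwoFactorization
          (CyclicFactorization.multipartiteGraph m n) 𝓕 ∧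
        CyclicFactorization.IsRegularUnderTranslation 𝓕) ↔
      m ≡ 1 [MOD 4] :=
  ⟨fun ⟨_, hF, hreg⟩ => CyclicFactorization.mod_four_of_factorization hm hn hn2 hF hreg,
    fun h => CyclicFactorization.exists_factorization h hn hn2⟩
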